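/- Let $H$ and $K$ be infinite-dimensional Hilbert spaces, both real or both complex, and let $B(H)$, $B(K)$ be the algebras of bounded linear operators on them. For operators $A,B$ write $A\circ B=\tfrac12(AB+BA)$. A minimal idempotent is a nonzero idempotent $P$ such that every idempotent $Q$ with $PQ=QP=Q$ is $0$ or $P$. Fix an orthonormal basis $(e_i)$ of $H$, and let $T^t$ denote the transpose of $T\in B(H)$ with respect to it, i.e. $\langle T^te_j,e_i\rangle=\langle Te_i,e_j\rangle$ for all $i,j$. Let $\phi:B(H)\to B(K)$ be an additive map whose range contains all minimal idempotents of $B(K)$ and the identity $I$, and suppose that for all $A,B\in B(H)$, $A\circ B$ is a nonzero idempotent if and only if $\phi(A)\circ\phi(B)$ is a nonzero idempotent. Then either $\phi(P)=0$ for every minimal idempotent $P\in B(H)$, or there exist $\xi\in\{1,-1\}$ and a bounded linear or conjugate-linear bijection $A:H\to K$ such that either $\phi(T)=\xi ATA^{-1}$ for every $T\in B(H)$, or $\phi(T)=\xi AT^tA^{-1}$ for every $T\in B(H)$. If $H$ and $K$ are real, then $A$ is linear. -/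

import Mathlib

open scoped InnerProductSpace

/-- A nonzero idempotent `P` of a ring is minimal if the only idempotents `Q ≤ P`
(that is, `P * Q = Q` and `Q * P = Q`) are `0` and `P`. -/
def IsMinimalIdempotent {R : Type*} [Ring R] (P : R) : Prop :=
  IsIdempotentElem P ∧ P ≠ 0 ∧
    ∀ Q : R, IsIdempotentElem Q → P * Q = Q → Q * P = Q → Q = 0 ∨ Q = P

/-- The Jordan product `(AB + BA) / 2` of two bounded operators. -/
noncomputable def jordanProduct {𝕜 H : Type*} [RCLike 𝕜] [NormedAddCommGroup H]
    [InnerProductSpace 𝕜 H] (A B : H →L[𝕜] H) : H →L[𝕜] H :=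
  (2⁻¹ : 𝕜) • (A * B + B * A)

/-- `φ` preserves the nonzero idempotency of Jordan products in both directions. -/
def PreservesNonzeroJordanIdempotency {𝕜 H K : Type*} [RCLike 𝕜]
    [NormedAddCommGroup H] [InnerProductSpace 𝕜 H]
    [NormedAddCommGroup K] [InnerProductSpace 𝕜 K]
    (φ : (H →L[𝕜] H) → (K →L[𝕜] K)) : Prop :=
  ∀ A B : H →L[𝕜] H,
    (IsIdempotentElem (jordanProduct A B) ∧ jordanProduct A B ≠ 0) ↔
      (IsIdempotentElem (jordanProduct (φ A) (φ B)) ∧ jordanProduct (φ A) (φ B) ≠ 0)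

/-- Coordinatewise complex conjugation `∑ xᵢ bᵢ ↦ ∑ conj(xᵢ) bᵢ` in a Hilbert space with
orthonormal (Hilbert) basis `b`. -/
noncomputable def basisConj {ι 𝕜 H : Type*} [RCLike 𝕜] [NormedAddCommGroup H]
    [InnerProductSpace 𝕜 H] (b : HilbertBasis ι 𝕜 H) : H ≃ₗᵢ⋆[𝕜] H :=
  (b.repr.trans (starₗᵢ 𝕜 : lp (fun _ : ι => 𝕜) 2 ≃ₗᵢ⋆[𝕜] lp (fun _ : ι => 𝕜) 2)).trans
    b.repr.symm

/-- The transpose `Tᵗ` of a bounded operator with respect to the orthonormal basis `b`: the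
adjoint of `T` conjugated by coordinatewise complex conjugation. -/
noncomputable def basisTranspose {ι 𝕜 H : Type*} [RCLike 𝕜] [NormedAddCommGroup H]
    [InnerProductSpace 𝕜 H] [CompleteSpace H] (b : HilbertBasis ι 𝕜 H) (T : H →L[𝕜] H) :
    H →L[𝕜] H :=
  (basisConj b : H →L⋆[𝕜] H).comp
    ((ContinuousLinearMap.adjoint T).comp (basisConj b : H →L⋆[𝕜] H))

theorem basisConj_basis {ι 𝕜 H : Type*} [RCLike 𝕜] [NormedAddCommGroup H]
    [InnerProductSpace 𝕜 H] (b : HilbertBasis ι 𝕜 H) (i : ι) :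
    basisConj b (b i) = b i := by
  classical
  apply b.repr.injective
  ext j
  simp only [basisConj, LinearIsometryEquiv.trans_apply, LinearIsometryEquiv.apply_symm_apply,
    HilbertBasis.repr_self]
  by_cases h : j = i
  · subst h; simp [lp.single_apply]
  · simp [lp.single_apply, h]

theorem inner_basis_basisConj {ι 𝕜 H : Type*} [RCLike 𝕜] [NormedAddCommGroup H]
    [InnerProductSpace 𝕜 H] (b : HilbertBasis ι 𝕜 H) (i : ι) (x : H) :
    ⟪b i, basisConj b x⟫_𝕜 = ⟪x, b i⟫_𝕜 := by
  rw [← b.repr_apply_apply, ← inner_conj_symm x (b i), ← b.repr_apply_apply]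
  simp [basisConj]

/-- The matrix of `basisTranspose b T` in the basis `b` is the transpose of the matrix of `T`. -/
theorem inner_basisTranspose {ι 𝕜 H : Type*} [RCLike 𝕜] [NormedAddCommGroup H]
    [InnerProductSpace 𝕜 H] [CompleteSpace H] (b : HilbertBasis ι 𝕜 H) (T : H →L[𝕜] H)
    (i j : ι) :
    ⟪b i, basisTranspose b T (b j)⟫_𝕜 = ⟪b j, T (b i)⟫_𝕜 := by
  have h : basisTranspose b T (b j) =
      basisConj b (ContinuousLinearMap.adjoint T (basisConj b (b j))) := rfl
  rw [h, inner_basis_basisConj, basisConj_basis, ContinuousLinearMap.adjoint_inner_left]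

/-- The operator `A T A⁻¹` on `K`, for a linear (`σ = id`) or conjugate-linear (`σ = conj`)
bounded bijection `A : H → K`. -/
noncomputable def conjugateBy {𝕜 H K : Type*} [RCLike 𝕜]
    [NormedAddCommGroup H] [InnerProductSpace 𝕜 H]
    [NormedAddCommGroup K] [InnerProductSpace 𝕜 K]
    {σ σ' : 𝕜 →+* 𝕜} [RingHomInvPair σ σ'] [RingHomInvPair σ' σ]
    (A : H ≃SL[σ] K) (T : H →L[𝕜] H) : K →L[𝕜] K :=
  (A : H →SL[σ] K).comp (T.comp (A.symm : K →SL[σ'] H))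

/-! Write f⊗x for `f.smulRight x`. Minimal idempotents are the rank-one idempotents, and for such a
Q the product Q∘T is a nonzero idempotent exactly when TQ = Q or QT = Q
(`isNonzeroIdempotent_jordanProduct_iff`). Either way QTQ = Q, so Q∘T₁, Q∘T₂ and Q∘(T₁ + T₂) are
never all nonzero idempotents. Among operators whose square is a nonzero idempotent, this singles
out the minimal idempotents up to sign. The property involves only sums and Jordan products, so φ
respects it in both directions. Testing φ(1) against these operators gives φ(1) = ±1, and passing to
-φ if necessary makes φ unital.

With T = S + 1 the criterion at P reads SP = 0 or PS = 0: a union of two subgroups, which determines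
the pair up to order. So φ keeps or exchanges left and right annihilation, and does the same at
every P. The transpose reduces exchanging to keeping. Then φ(TF) = φ(T)φ(F) for rank-one F, and u ↦
φ(f₀⊗u)y₀ is an additive bijection A with φ(T)A = AT, semilinear over a ring endomorphism σ of the
scalars. A diagonal operator shows that σ is bounded on the unit ball, hence the identity or the
conjugation; the closed graph theorem makes A⁻¹ continuous. -/

section RankOne

/-! ### Rank-one operators and minimal idempotents. -/

variable {𝕜 H : Type*} [RCLike 𝕜] [NormedAddCommGroup H] [InnerProductSpace 𝕜 H]

theorem exists_dual_eq_one_eq_zero {u v : H} (h : ∀ c : 𝕜, v ≠ c • u) :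
    ∃ f : H →L[𝕜] 𝕜, f v = 1 ∧ f u = 0 := by
  rcases eq_or_ne u 0 with rfl | hu
  · obtain ⟨f, hf⟩ := SeparatingDual.exists_eq_one (R := 𝕜) (x := v) (by simpa using h 0)
    exact ⟨f, hf, by simp⟩
  · obtain ⟨g, hg⟩ := SeparatingDual.exists_eq_one (R := 𝕜) hu
    obtain ⟨k, hk⟩ := SeparatingDual.exists_eq_one (R := 𝕜) (sub_ne_zero.2 (h (g v)))
    -- Since g u = 1, the correction kills u, and the value at v is k (v - g v • u) = 1.
    refine ⟨k - k u • g, ?_, by simp [hg]⟩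
    simp only [map_sub, map_smul, smul_eq_mul] at hk
    simp only [_root_.sub_apply, _root_.smul_apply, smul_eq_mul]
    rw [← hk]; ring

theorem smulRight_mul_smulRight (f g : H →L[𝕜] 𝕜) (x y : H) :
    f.smulRight x * g.smulRight y = f y • g.smulRight x := by
  ext z; simp [smul_smul, mul_comm]

theorem mul_smulRight (T : H →L[𝕜] H) (f : H →L[𝕜] 𝕜) (x : H) :
    T * f.smulRight x = f.smulRight (T x) := by
  ext z; simp

theorem smulRight_mul_apply (T : H →L[𝕜] H) (f : H →L[𝕜] 𝕜) (x z : H) :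
    (f.smulRight x * T) z = f (T z) • x := by
  simp

theorem smulRight_eq_zero {f : H →L[𝕜] 𝕜} {x : H} (h : f.smulRight x = 0) (hf : f ≠ 0) :
    x = 0 := by
  obtain ⟨z, hz⟩ := DFunLike.ne_iff.1 hf
  have := congrArg (fun S : H →L[𝕜] H => S z) h
  simpa [smul_eq_zero, show f z ≠ 0 from hz] using this

theorem ne_zero_of_apply_eq_one {f : H →L[𝕜] 𝕜} {x : H} (h : f x = 1) : f ≠ 0 ∧ x ≠ 0 := by
  constructor <;> rintro rfl <;> simp at h

/-- If f(Pw) = 1, then (f∘P)⊗(Pw) is a nonzero idempotent below P, so it equals P by minimality.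
Conversely, an idempotent below f⊗x is a scalar multiple of it, and the scalar is idempotent. -/
theorem isMinimalIdempotent_iff (P : H →L[𝕜] H) :
    IsMinimalIdempotent P ↔ ∃ (x : H) (f : H →L[𝕜] 𝕜), f x = 1 ∧ P = f.smulRight x := by
  constructor
  · rintro ⟨hP, h0, hmin⟩
    obtain ⟨w, hw⟩ : ∃ w, P w ≠ 0 := by
      by_contra! h
      exact h0 (by ext z; simp [h z])
    have hPP : ∀ z, P (P z) = P z := fun z => congrArg (fun S : H →L[𝕜] H => S z) hP.eq
    obtain ⟨f, hf⟩ := SeparatingDual.exists_eq_one (R := 𝕜) hw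
    refine ⟨P w, f.comp P, by simp [hPP, hf], ?_⟩
    have := hmin ((f.comp P).smulRight (P w)) ?_ ?_ ?_
    · rcases this with h | h
      · exact absurd (smulRight_eq_zero h (ne_zero_of_apply_eq_one (x := P w)
          (by simp [hPP, hf])).1) hw
      · exact h.symm
    · ext z; simp [hPP, hf]
    · ext z; simp [hPP]
    · ext z; simp [hPP]
  · rintro ⟨x, f, hf, rfl⟩
    refine ⟨?_, ?_, ?_⟩
    · ext z; simp [hf]
    · intro h
      exact (ne_zero_of_apply_eq_one hf).2 (smulRight_eq_zero h (ne_zero_of_apply_eq_one hf).1)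
    · intro Q hQ h1 h2
      have hQ' : Q = f (Q x) • f.smulRight x := by
        have : Q = f.smulRight x * Q * f.smulRight x := by rw [h1, h2]
        rw [this]; ext z; simp [hf, mul_comm, smul_smul]
      have hc : f (Q x) * f (Q x) = f (Q x) := by
        have : Q (Q x) = Q x := congrArg (fun S : H →L[𝕜] H => S x) hQ.eq
        have h3 : Q x = f (Q x) • x := by
          conv_lhs => rw [hQ']
          simp [hf]
        have h4 := congrArg f this
        rw [h3, map_smul, h3] at h4
        simpa [hf] using h4
      rcases IsIdempotentElem.iff_eq_zero_or_one.1 hc with h | h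
      · left; rw [hQ', h]; simp
      · right; rw [hQ', h]; simp

theorem isMinimalIdempotent_smulRight {f : H →L[𝕜] 𝕜} {x : H} (h : f x = 1) :
    IsMinimalIdempotent (f.smulRight x) :=
  (isMinimalIdempotent_iff _).2 ⟨x, f, h, rfl⟩

/-- Rank-one nilpotents are differences of minimal idempotents. -/
theorem smulRight_mem_closure_of_apply_eq_zero {f : H →L[𝕜] 𝕜} {x : H} (h : f x = 0) :
    f.smulRight x ∈ AddSubgroup.closure {P : H →L[𝕜] H | IsMinimalIdempotent P} := by
  rcases eq_or_ne f 0 with rfl | hf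
  · convert! AddSubgroup.zero_mem _
    ext z; simp
  obtain ⟨w, hw⟩ : ∃ w, f w = 1 := by
    obtain ⟨z, hz⟩ := DFunLike.ne_iff.1 hf
    exact ⟨(f z)⁻¹ • z, by simpa using inv_mul_cancel₀ hz⟩
  have : f.smulRight x = f.smulRight (w + x) - f.smulRight w := by
    ext z; simp
  rw [this]
  exact AddSubgroup.sub_mem _
    (AddSubgroup.subset_closure (isMinimalIdempotent_smulRight (by simp [hw, h])))
    (AddSubgroup.subset_closure (isMinimalIdempotent_smulRight hw))

end RankOne

/-! ### Jordan products with minimal idempotents. -/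

section Jordan

/-- A nonzero idempotent of a ring. -/
def IsNonzeroIdempotent {R : Type*} [Ring R] (X : R) : Prop := IsIdempotentElem X ∧ X ≠ 0

theorem IsMinimalIdempotent.isNonzeroIdempotent {R : Type*} [Ring R] {P : R}
    (h : IsMinimalIdempotent P) : IsNonzeroIdempotent P := ⟨h.1, h.2.1⟩

theorem IsNonzeroIdempotent.add {R : Type*} [Ring R] {P N : R} (hP : IsNonzeroIdempotent P)
    (hN : IsIdempotentElem N) (h1 : P * N = 0) (h2 : N * P = 0) : IsNonzeroIdempotent (P + N) := by
  refine ⟨?_, fun h => hP.2 ?_⟩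
  · simp only [IsIdempotentElem, add_mul, mul_add, h1, h2, hP.1.eq, hN.eq, zero_add, add_zero]
  · have := congrArg (P * ·) h
    simpa [mul_add, h1, hP.1.eq] using this

variable {𝕜 H : Type*} [RCLike 𝕜] [NormedAddCommGroup H] [InnerProductSpace 𝕜 H]

theorem jordanProduct_neg (A B : H →L[𝕜] H) : jordanProduct A (-B) = jordanProduct (-A) B := by
  simp [jordanProduct]

theorem jordanProduct_neg_neg (A B : H →L[𝕜] H) : jordanProduct (-A) (-B) = jordanProduct A B := by
  simp [jordanProduct]

theorem jordanProduct_add (A B C : H →L[𝕜] H) :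
    jordanProduct A (B + C) = jordanProduct A B + jordanProduct A C := by
  simp only [jordanProduct, ← smul_add]; congr 1; noncomm_ring

theorem half_smul_add_self (X : H →L[𝕜] H) : (2⁻¹ : 𝕜) • (X + X) = X := by
  rw [← two_smul 𝕜 X, smul_smul]; simp

theorem jordanProduct_of_commute {A B : H →L[𝕜] H} (h : A * B = B * A) :
    jordanProduct A B = A * B := by
  rw [jordanProduct, ← h, half_smul_add_self]

theorem isNonzeroIdempotent_half_smul (X : H →L[𝕜] H) :
    IsNonzeroIdempotent ((2⁻¹ : 𝕜) • X) ↔ X * X = X + X ∧ X ≠ 0 := by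
  unfold IsNonzeroIdempotent IsIdempotentElem
  refine and_congr ?_ (by simp)
  rw [smul_mul_smul_comm]
  constructor
  · intro h
    have h2 := congrArg ((4 : 𝕜) • ·) h
    simp only [smul_smul] at h2
    norm_num at h2
    rw [h2, two_smul]
  · intro h
    rw [h, ← two_smul 𝕜 X, smul_smul]
    norm_num

/-- The Jordan product with a minimal idempotent `Q` is a nonzero idempotent exactly when the
other factor fixes `Q` from one side. -/
theorem isNonzeroIdempotent_jordanProduct_iff {Q : H →L[𝕜] H} (hQ : IsMinimalIdempotent Q)
    (T : H →L[𝕜] H) :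
    IsNonzeroIdempotent (jordanProduct Q T) ↔ T * Q = Q ∨ Q * T = Q := by
  rw [jordanProduct, isNonzeroIdempotent_half_smul]
  have hQQ : Q * Q = Q := hQ.1.eq
  have hQ0 := hQ.2.1
  constructor
  · obtain ⟨x, f, hf, rfl⟩ := (isMinimalIdempotent_iff Q).1 hQ
    set Q := f.smulRight x with hQdef
    rintro ⟨h, h0⟩
    set l := f (T x) with hl
    -- Compressing X² = 2X, with X = QT + TQ, by 1 - Q on both sides leaves (1 - Q)TQT(1 - Q) = 0.
    -- This is a rank-one product, so its vector or its functional vanishes: TQ = lQ or QT = lQ.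
    have hprod : ∀ z, (f (T z) - l * f z) • (T x - l • x) = 0 := by
      intro z
      have e : (1 - Q) * ((Q * T + T * Q) * (Q * T + T * Q)) * (1 - Q) =
          (1 - Q) * ((Q * T + T * Q) + (Q * T + T * Q)) * (1 - Q) := by rw [h]
      have e1 : (1 - Q) * ((Q * T + T * Q) * (Q * T + T * Q)) * (1 - Q) =
          (1 - Q) * (T * (Q * Q) * T) * (1 - Q) + (1 - Q) * Q * (T * Q * T + T * T * Q) * (1 - Q)
           + (1 - Q) * T * Q * T * (Q * (1 - Q)) := by noncomm_ring
      have e2 : (1 - Q) * ((Q * T + T * Q) + (Q * T + T * Q)) * (1 - Q) =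
          (1 - Q) * Q * (T + T) * (1 - Q) + (1 - Q) * (T + T) * (Q * (1 - Q)) := by noncomm_ring
      have e3 : (1 - Q) * Q = 0 := by rw [sub_mul, hQQ, one_mul, sub_self]
      have e4 : Q * (1 - Q) = 0 := by rw [mul_sub, hQQ, mul_one, sub_self]
      rw [e1, e2, e3, e4, hQQ] at e
      simp only [zero_mul, mul_zero, add_zero] at e
      have e5 := congrArg (fun S : H →L[𝕜] H => S z) e
      refine Eq.trans ?_ e5
      simp only [hQdef, _root_.sub_apply, mul_apply_eq_comp,
        one_apply_eq_self, ContinuousLinearMap.smulRight_apply, map_sub, map_smul,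
        ← hl]
      module
    have hidem : l * l = l → l = 0 ∨ l = 1 := fun h => IsIdempotentElem.iff_eq_zero_or_one.1 h
    have hx : (Q * T + T * Q) ((Q * T + T * Q) x) = (Q * T + T * Q) x + (Q * T + T * Q) x :=
      congrArg (fun S : H →L[𝕜] H => S x) h
    have h4 : (4 : 𝕜) ≠ 0 := by norm_num
    by_cases hc : T x - l • x = 0
    · have hTx : T x = l • x := sub_eq_zero.1 hc
      have hTQ : T * Q = l • Q := by
        ext z; simp [hQdef, hTx, smul_smul, mul_comm]
      rcases hidem (mul_left_cancel₀ h4 (by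
          have := congrArg f hx
          simp [hQdef, hTx, hf] at this
          linear_combination this)) with h1 | h1
      · exfalso
        rw [h1, zero_smul] at hTQ
        rw [hTQ, add_zero] at h h0
        rw [show Q * T * (Q * T) = Q * (T * Q) * T by noncomm_ring, hTQ, mul_zero, zero_mul] at h
        exact h0 (by rw [← half_smul_add_self (𝕜 := 𝕜) (Q * T), ← h, smul_zero])
      · left; rw [hTQ, h1, one_smul]
    · have hfT : ∀ z, f (T z) = l * f z := fun z =>
        sub_eq_zero.1 ((smul_eq_zero.1 (hprod z)).resolve_right hc)
      have hQT : Q * T = l • Q := by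
        ext z; simp [hQdef, hfT, smul_smul]
      rcases hidem (mul_left_cancel₀ h4 (by
          have := congrArg f hx
          simp [hQdef, hfT, hf] at this
          linear_combination this)) with h1 | h1
      · exfalso
        rw [h1, zero_smul] at hQT
        rw [hQT, zero_add] at h h0
        rw [show T * Q * (T * Q) = T * (Q * T) * Q by noncomm_ring, hQT, mul_zero, zero_mul] at h
        exact h0 (by rw [← half_smul_add_self (𝕜 := 𝕜) (T * Q), ← h, smul_zero])
      · right; rw [hQT, h1, one_smul]
  · intro h
    refine ⟨?_, ?_⟩
    · rcases h with h | h
      · rw [h]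
        calc (Q * T + Q) * (Q * T + Q) = Q * (T * Q) * T + Q * (T * Q) + Q * Q * T + Q * Q := by
              noncomm_ring
          _ = _ := by rw [h, hQQ]; abel
      · rw [h]
        calc (Q + T * Q) * (Q + T * Q) = Q * Q + Q * T * Q + T * (Q * Q) + T * ((Q * T) * Q) := by
              noncomm_ring
          _ = _ := by rw [h, hQQ]; abel
    · intro h0
      apply hQ0
      rw [← half_smul_add_self (𝕜 := 𝕜) Q]
      rcases h with h | h
      · have := congrArg (· * Q) h0
        simp only [add_mul, mul_assoc, h, hQQ, zero_mul] at this
        rw [this, smul_zero]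
      · have := congrArg (Q * ·) h0
        simp only [mul_add, ← mul_assoc, h, hQQ, mul_zero] at this
        rw [this, smul_zero]

theorem IsMinimalIdempotent.mul_mul_of_jordanProduct {Q T : H →L[𝕜] H}
    (hQ : IsMinimalIdempotent Q) (h : IsNonzeroIdempotent (jordanProduct Q T)) : Q * T * Q = Q := by
  rcases (isNonzeroIdempotent_jordanProduct_iff hQ T).1 h with h | h
  · rw [mul_assoc, h, hQ.1.eq]
  · rw [h, hQ.1.eq]

/-- All three together would give Q = Q(T₁ + T₂)Q = Q + Q. -/
theorem IsMinimalIdempotent.not_jordanProduct_add {Q T₁ T₂ : H →L[𝕜] H}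
    (hQ : IsMinimalIdempotent Q) (h₁ : IsNonzeroIdempotent (jordanProduct Q T₁))
    (h₂ : IsNonzeroIdempotent (jordanProduct Q T₂)) :
    ¬ IsNonzeroIdempotent (jordanProduct Q (T₁ + T₂)) := by
  intro h
  have h := hQ.mul_mul_of_jordanProduct h
  rw [mul_add, add_mul, hQ.mul_mul_of_jordanProduct h₁, hQ.mul_mul_of_jordanProduct h₂] at h
  exact hQ.2.1 (left_eq_add.1 h.symm)

/-- An operator whose square is a nonzero idempotent has, up to sign, a reducing rank-one
idempotent. -/
theorem exists_minimalIdempotent_reducing {A : H →L[𝕜] H} (h : IsNonzeroIdempotent (A * A)) :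
    ∃ P : H →L[𝕜] H, IsMinimalIdempotent P ∧
      ((A * P = P ∧ P * A = P) ∨ (-A * P = P ∧ P * -A = P)) := by
  have key : ∀ (B : H →L[𝕜] H) (x : H), B * B * (B * B) = B * B → x ≠ 0 → B x = x →
      ∃ P : H →L[𝕜] H, IsMinimalIdempotent P ∧ B * P = P ∧ P * B = P := by
    intro B x hB hx hBx
    obtain ⟨f, hf⟩ := SeparatingDual.exists_eq_one (R := 𝕜) hx
    -- As B² is idempotent, (B + 1)B² absorbs B on the right, so g∘B = g; the factor 1/2 gives g x =
    -- 1 because B x = x.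
    let g : H →L[𝕜] 𝕜 := (2⁻¹ : 𝕜) • f.comp ((B + 1) * (B * B))
    have hg : g x = 1 := by
      simp only [g, _root_.smul_apply, ContinuousLinearMap.comp_apply,
        mul_apply_eq_comp, _root_.add_apply, one_apply_eq_self, hBx,
        map_add, hf, smul_eq_mul]
      norm_num
    have hgB : g.comp B = g := by
      have e : (B + 1) * (B * B) * B = (B + 1) * (B * B) := by
        calc (B + 1) * (B * B) * B = B * B * (B * B) + B * B * B := by noncomm_ring
          _ = _ := by rw [hB]; noncomm_ring
      ext z
      have := congrArg (fun S : H →L[𝕜] H => (2⁻¹ : 𝕜) • f (S z)) e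
      simpa [g] using this
    refine ⟨g.smulRight x, isMinimalIdempotent_smulRight hg, ?_, ?_⟩
    · rw [mul_smulRight, hBx]
    · ext z
      have := congrArg (fun S : H →L[𝕜] 𝕜 => S z) hgB
      simp only [ContinuousLinearMap.comp_apply] at this
      rw [smulRight_mul_apply, this]; rfl
  obtain ⟨w, hw⟩ : ∃ w, (A * A) w ≠ 0 := by
    by_contra! h'
    exact h.2 (by ext z; simpa using h' z)
  have hE : A * A * (A * A) = A * A := h.1.eq
  set z := (A * A) w with hz
  have hz' : A (A z) = z := congrArg (fun S : H →L[𝕜] H => S w) hE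
  -- Since A²z = z, the vector z + Az is fixed by A; if it is zero, z is fixed by -A.
  by_cases h1 : z + A z = 0
  · obtain ⟨P, hP, h2⟩ := key (-A) z (by simpa using hE) hw
      (by rw [_root_.neg_apply]; exact (eq_neg_of_add_eq_zero_left h1).symm)
    exact ⟨P, hP, Or.inr h2⟩
  · obtain ⟨P, hP, h2⟩ := key A (z + A z) hE h1 (by rw [map_add, hz', add_comm])
    exact ⟨P, hP, Or.inl h2⟩

/-- An operator whose square is a nonzero idempotent is, up to sign, a minimal idempotent, unless
its Jordan products include two nonzero idempotents whose sum is again idempotent. -/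
theorem minimalIdempotent_or_exists_jordanProduct_add {A : H →L[𝕜] H}
    (h : IsNonzeroIdempotent (A * A)) :
    (IsMinimalIdempotent A ∨ IsMinimalIdempotent (-A)) ∨
    ∃ T₁ ∈ AddSubgroup.closure {P : H →L[𝕜] H | IsMinimalIdempotent P},
    ∃ T₂ ∈ AddSubgroup.closure {P : H →L[𝕜] H | IsMinimalIdempotent P},
      IsNonzeroIdempotent (jordanProduct A T₁) ∧ IsNonzeroIdempotent (jordanProduct A T₂) ∧
      IsNonzeroIdempotent (jordanProduct A (T₁ + T₂)) := by
  have key : ∀ A P : H →L[𝕜] H, IsNonzeroIdempotent (A * A) → IsMinimalIdempotent P →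
      A * P = P → P * A = P → IsMinimalIdempotent A ∨
    ∃ T₁ ∈ AddSubgroup.closure {P : H →L[𝕜] H | IsMinimalIdempotent P},
    ∃ T₂ ∈ AddSubgroup.closure {P : H →L[𝕜] H | IsMinimalIdempotent P},
      IsNonzeroIdempotent (jordanProduct A T₁) ∧ IsNonzeroIdempotent (jordanProduct A T₂) ∧
      IsNonzeroIdempotent (jordanProduct A (T₁ + T₂)) := by
    intro A P hA hP hAP hPA
    have hPP : P * P = P := hP.1.eq
    -- A splits as P + B with PB = BP = 0. If B ≠ 0, take T₁ = P and look for T₂ with A∘T₂ a nonzero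
    -- idempotent orthogonal to P.
    obtain ⟨B, hB⟩ : ∃ B, B = A - P := ⟨_, rfl⟩
    have hAB : A = P + B := by rw [hB]; abel
    have hBP : B * P = 0 := by rw [hB, sub_mul, hAP, hPP, sub_self]
    have hPB : P * B = 0 := by rw [hB, mul_sub, hPA, hPP, sub_self]
    have hBB : A * A = P + B * B := by
      rw [hAB, add_mul, mul_add, mul_add, hPP, hBP, hPB, add_zero, zero_add]
    have hBi : IsIdempotentElem (B * B) := by
      have := hA.1.eq
      rw [hBB, add_mul, mul_add, mul_add, hPP, mul_assoc B B P, hBP, ← mul_assoc P B B, hPB,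
        mul_zero, zero_mul, add_zero, zero_add] at this
      exact add_left_cancel this
    have hJP : jordanProduct A P = P := by
      rw [jordanProduct_of_commute (hAP.trans hPA.symm), hAP]
    rcases eq_or_ne B 0 with hB0 | hB0
    · left; rwa [hAB, hB0, add_zero]
    right
    suffices ∃ T ∈ AddSubgroup.closure {P : H →L[𝕜] H | IsMinimalIdempotent P},
        IsNonzeroIdempotent (jordanProduct A T) ∧ P * jordanProduct A T = 0 ∧
        jordanProduct A T * P = 0 by
      obtain ⟨T, hT, h1, h2, h3⟩ := this
      refine ⟨P, AddSubgroup.subset_closure hP, T, hT, ?_, h1, ?_⟩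
      · rw [hJP]; exact hP.isNonzeroIdempotent
      · rw [jordanProduct_add, hJP]
        exact hP.isNonzeroIdempotent.add h1.1 h2 h3
    -- For B² = 0, take Pu = 0, Bu ≠ 0 and h vanishing at u and on the range of P, with h(Bu) = 1.
    -- Then A∘(h⊗2u) = h⊗Bu + (h∘B)⊗u is an idempotent with range spanned by u and Bu. Otherwise a
    -- minimal idempotent reducing ±B serves, up to sign.
    by_cases hB2 : B * B = 0
    · obtain ⟨u₀, hu₀⟩ : ∃ u, B u ≠ 0 := by
        by_contra! h'
        exact hB0 (by ext z; simpa using h' z)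
      obtain ⟨u, hu⟩ : ∃ u, u = u₀ - P u₀ := ⟨_, rfl⟩
      have ap : ∀ {S T : H →L[𝕜] H}, S = T → ∀ z, S z = T z := fun h z => by rw [h]
      have hBPz : ∀ z, B (P z) = 0 := ap hBP
      have hPBz : ∀ z, P (B z) = 0 := ap hPB
      have hBBz : ∀ z, B (B z) = 0 := ap hB2
      have hPPz : ∀ z, P (P z) = P z := ap hPP
      have hBu : B u ≠ 0 := by rwa [hu, map_sub, hBPz, sub_zero]
      have hPu : P u = 0 := by rw [hu, map_sub, hPPz, sub_self]
      obtain ⟨k, hk1, hk0⟩ := exists_dual_eq_one_eq_zero (𝕜 := 𝕜) (u := u) (v := B u) (by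
        intro c hc
        have := congrArg B hc
        rw [map_smul, hBBz] at this
        rcases smul_eq_zero.1 this.symm with h | h
        · rw [h, zero_smul] at hc; exact hBu hc
        · exact hBu h)
      obtain ⟨h, hh⟩ : ∃ h : H →L[𝕜] 𝕜, h = k - k.comp P := ⟨_, rfl⟩
      have hhz : ∀ z, h z = k z - k (P z) := fun z => by rw [hh]; rfl
      have hh1 : h (B u) = 1 := by rw [hhz, hPBz, map_zero, sub_zero, hk1]
      have hh0 : h u = 0 := by rw [hhz, hPu, map_zero, sub_zero, hk0]
      have hhP : ∀ z, h (P z) = 0 := fun z => by rw [hhz, hPPz, sub_self]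
      have hJ : ∀ z, jordanProduct A (h.smulRight ((2 : 𝕜) • u)) z = h z • B u + h (B z) • u := by
        intro z
        rw [jordanProduct, mul_smulRight, hAB]
        simp only [_root_.smul_apply, _root_.add_apply, mul_apply_eq_comp,
          ContinuousLinearMap.smulRight_apply, map_add, hhP, map_smul, hPu]
        module
      refine ⟨h.smulRight ((2 : 𝕜) • u), smulRight_mem_closure_of_apply_eq_zero (by simp [hh0]),
        ⟨?_, ?_⟩, ?_, ?_⟩
      · ext z
        simp only [mul_apply_eq_comp, hJ, map_add, map_smul, hh1, hh0, hBBz, smul_zero,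
          smul_eq_mul, mul_zero, mul_one, add_zero, zero_add]
      · intro h0
        have := hJ u
        rw [h0, hh0, hh1] at this
        rw [_root_.zero_apply, zero_smul, one_smul, zero_add] at this
        exact hBu (by rw [← this, map_zero])
      · ext z
        simp [hJ, hPBz, hPu]
      · ext z
        simp [hJ, hBPz, hhP]
    · obtain ⟨R, hR, hR'⟩ := exists_minimalIdempotent_reducing (A := B) ⟨hBi, hB2⟩
      have main : ∀ C : H →L[𝕜] H, C * P = 0 → P * C = 0 → C * R = R → R * C = R →
          P * R = 0 ∧ R * P = 0 := by
        intro C h1 h2 h3 h4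
        refine ⟨?_, ?_⟩
        · rw [← h3, ← mul_assoc, h2, zero_mul]
        · rw [← h4, mul_assoc, h1, mul_zero]
      rcases hR' with ⟨h1, h2⟩ | ⟨h1, h2⟩
      · obtain ⟨h3, h4⟩ := main B hBP hPB h1 h2
        have hJ : jordanProduct A R = R := by
          have e : A * R = R := by rw [hAB, add_mul, h3, h1, zero_add]
          rw [jordanProduct_of_commute (e.trans ?_), e]
          rw [hAB, mul_add, h4, h2, zero_add]
        exact ⟨R, AddSubgroup.subset_closure hR, by
          rw [hJ]; exact ⟨hR.isNonzeroIdempotent, h3, h4⟩⟩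
      · obtain ⟨h3, h4⟩ := main (-B) (by rw [neg_mul, hBP, neg_zero])
          (by rw [mul_neg, hPB, neg_zero]) h1 h2
        have hJ : jordanProduct A (-R) = R := by
          have e : A * -R = R := by rw [hAB, add_mul, mul_neg, h3, mul_neg, ← neg_mul, h1]; simp
          rw [jordanProduct_of_commute (e.trans ?_), e]
          rw [hAB, mul_add, neg_mul, h4, neg_mul, ← mul_neg, h2]; simp
        exact ⟨-R, AddSubgroup.neg_mem _ (AddSubgroup.subset_closure hR), by
          rw [hJ]; exact ⟨hR.isNonzeroIdempotent, h3, h4⟩⟩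
  obtain ⟨P, hP, ⟨h1, h2⟩ | ⟨h1, h2⟩⟩ := exists_minimalIdempotent_reducing h
  · rcases key A P h hP h1 h2 with h3 | h3
    · exact Or.inl (Or.inl h3)
    · exact Or.inr h3
  · rcases key (-A) P (by simpa using h) hP h1 h2 with h3 | ⟨T₁, hT₁, T₂, hT₂, h4, h5, h6⟩
    · exact Or.inl (Or.inr h3)
    · refine Or.inr ⟨-T₁, neg_mem hT₁, -T₂, neg_mem hT₂, ?_, ?_, ?_⟩
      · rwa [jordanProduct_neg]
      · rwa [jordanProduct_neg]
      · rwa [← neg_add, jordanProduct_neg]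

end Jordan

/-- Two pairs of subgroups with the same union coincide up to order, if the first pair is
incomparable. -/
theorem AddSubgroup.eq_or_swap_of_union_eq {G : Type*} [AddGroup G] {W₁ W₂ V₁ V₂ : AddSubgroup G}
    (h : ∀ x, (x ∈ W₁ ∨ x ∈ W₂) ↔ (x ∈ V₁ ∨ x ∈ V₂)) (h₁ : ¬ W₁ ≤ W₂) (h₂ : ¬ W₂ ≤ W₁) :
    (W₁ = V₁ ∧ W₂ = V₂) ∨ (W₁ = V₂ ∧ W₂ = V₁) := by
  have split : ∀ {A B C : AddSubgroup G}, (∀ x ∈ A, x ∈ B ∨ x ∈ C) → A ≤ B ∨ A ≤ C :=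
    fun h => AddSubgroupClass.subset_union.1 h
  have key : ∀ {V₁ V₂ : AddSubgroup G}, (∀ x, (x ∈ W₁ ∨ x ∈ W₂) ↔ (x ∈ V₁ ∨ x ∈ V₂)) →
      W₁ ≤ V₁ → W₁ = V₁ ∧ W₂ = V₂ := by
    intro V₁ V₂ h h3
    have e1 : V₁ = W₁ := by
      rcases split (fun x hx => (h x).2 (Or.inl hx)) with h4 | h4
      · exact le_antisymm h4 h3
      · exact absurd (h3.trans h4) h₁
    have h5 : W₂ ≤ V₂ := by
      rcases split (fun x hx => (h x).1 (Or.inr hx)) with h5 | h5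
      · exact absurd (h5.trans e1.le) h₂
      · exact h5
    refine ⟨e1.symm, le_antisymm h5 ?_⟩
    rcases split (fun x hx => (h x).2 (Or.inr hx)) with h6 | h6
    · exact absurd (h5.trans h6) h₂
    · exact h6
  rcases split (fun x hx => (h x).1 (Or.inl hx)) with h3 | h3
  · exact Or.inl (key h h3)
  · exact Or.inr (key (fun x => (h x).trans or_comm) h3)

theorem sub_one_mul_eq_zero_iff {R : Type*} [Ring R] {x y : R} : (x - 1) * y = 0 ↔ x * y = y := by
  rw [sub_one_mul, sub_eq_zero]

theorem mul_sub_one_eq_zero_iff {R : Type*} [Ring R] {x y : R} : y * (x - 1) = 0 ↔ y * x = y := by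
  rw [mul_sub_one, sub_eq_zero]

/-! ### Minimal idempotents, the identity and annihilators under φ. -/

section Preserver

variable {𝕜 H K : Type*} [RCLike 𝕜] [NormedAddCommGroup H] [InnerProductSpace 𝕜 H]
  [NormedAddCommGroup K] [InnerProductSpace 𝕜 K] {φ : (H →L[𝕜] H) →+ (K →L[𝕜] K)}

theorem PreservesNonzeroJordanIdempotency.iff {φ : (H →L[𝕜] H) → (K →L[𝕜] K)}
    (hφ : PreservesNonzeroJordanIdempotency φ) (A B : H →L[𝕜] H) :
    IsNonzeroIdempotent (jordanProduct A B) ↔ IsNonzeroIdempotent (jordanProduct (φ A) (φ B)) :=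
  hφ A B

theorem jordanProduct_self (A : H →L[𝕜] H) : jordanProduct A A = A * A :=
  jordanProduct_of_commute rfl

theorem isNonzeroIdempotent_mul_self {A : H →L[𝕜] H}
    (h : IsMinimalIdempotent A ∨ IsMinimalIdempotent (-A)) : IsNonzeroIdempotent (A * A) := by
  rcases h with h | h
  · rw [h.1.eq]; exact h.isNonzeroIdempotent
  · rw [← neg_mul_neg, h.1.eq]; exact h.isNonzeroIdempotent

theorem not_jordanProduct_add {A T₁ T₂ : H →L[𝕜] H}
    (h : IsMinimalIdempotent A ∨ IsMinimalIdempotent (-A))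
    (h₁ : IsNonzeroIdempotent (jordanProduct A T₁))
    (h₂ : IsNonzeroIdempotent (jordanProduct A T₂)) :
    ¬ IsNonzeroIdempotent (jordanProduct A (T₁ + T₂)) := by
  rcases h with h | h
  · exact h.not_jordanProduct_add h₁ h₂
  · rw [← jordanProduct_neg_neg] at h₁ h₂ ⊢
    rw [neg_add]
    exact h.not_jordanProduct_add h₁ h₂

/-- The witnesses T₁, T₂ that rule out other operators transfer along φ. In K they are sums of
signed minimal idempotents, which is why they lie in the range of φ. -/
theorem isMinimalIdempotent_or_neg_map_iff
    (hmin : ∀ P : K →L[𝕜] K, IsMinimalIdempotent P → P ∈ Set.range φ)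
    (hφ : PreservesNonzeroJordanIdempotency φ) (A : H →L[𝕜] H) :
    (IsMinimalIdempotent (φ A) ∨ IsMinimalIdempotent (-φ A)) ↔
      (IsMinimalIdempotent A ∨ IsMinimalIdempotent (-A)) := by
  constructor
  · intro h
    have hA : IsNonzeroIdempotent (A * A) := by
      rw [← jordanProduct_self, hφ.iff, jordanProduct_self]
      exact isNonzeroIdempotent_mul_self h
    refine (minimalIdempotent_or_exists_jordanProduct_add hA).resolve_right ?_
    rintro ⟨T₁, -, T₂, -, h1, h2, h3⟩
    rw [hφ.iff] at h1 h2 h3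
    rw [map_add] at h3
    exact not_jordanProduct_add h h1 h2 h3
  · intro h
    have hA : IsNonzeroIdempotent (φ A * φ A) := by
      rw [← jordanProduct_self, ← hφ.iff, jordanProduct_self]
      exact isNonzeroIdempotent_mul_self h
    have hle : AddSubgroup.closure {P : K →L[𝕜] K | IsMinimalIdempotent P} ≤ φ.range :=
      (AddSubgroup.closure_le _).2 fun P hP => hmin P hP
    refine (minimalIdempotent_or_exists_jordanProduct_add hA).resolve_right ?_
    rintro ⟨T₁, hT₁, T₂, hT₂, h1, h2, h3⟩
    obtain ⟨S₁, rfl⟩ := hle hT₁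
    obtain ⟨S₂, rfl⟩ := hle hT₂
    rw [← map_add, ← hφ.iff] at h3
    rw [← hφ.iff] at h1 h2
    exact not_jordanProduct_add h h1 h2 h3

theorem jordanProduct_one (A : H →L[𝕜] H) : jordanProduct A 1 = A := by
  rw [jordanProduct_of_commute (by rw [mul_one, one_mul]), mul_one]

/-- Testing against every rank-one idempotent gives f(φ(1)x) = ±1 whenever f x = 1, hence φ(1)x = ±x
for each x. The sign is global because a group is not a union of two proper subgroups. -/
theorem map_one_eq_one_or_neg_one
    (hmin : ∀ P : K →L[𝕜] K, IsMinimalIdempotent P → P ∈ Set.range φ)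
    (hφ : PreservesNonzeroJordanIdempotency φ) : φ 1 = 1 ∨ φ 1 = -1 := by
  have h1 : ∀ (x : K) (f : K →L[𝕜] 𝕜), f x = 1 → f (φ 1 x) = 1 ∨ f (φ 1 x) = -1 := by
    intro x f hf
    have hQ := isMinimalIdempotent_smulRight hf
    have key : ∀ U : K →L[𝕜] K,
        IsNonzeroIdempotent (jordanProduct (f.smulRight x) U) → f (U x) = 1 := by
      intro U hU
      have := congrArg (fun S : K →L[𝕜] K => f (S x)) (hQ.mul_mul_of_jordanProduct hU)
      simpa [hf] using this
    obtain ⟨A, hA⟩ := hmin _ hQ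
    have hA' := (isMinimalIdempotent_or_neg_map_iff hmin hφ A).1 (Or.inl (hA ▸ hQ))
    rcases hA' with h | h
    · left
      apply key
      rw [← hA, ← hφ.iff, jordanProduct_one]
      exact h.isNonzeroIdempotent
    · right
      have h2 := h.isNonzeroIdempotent
      rw [← jordanProduct_one (-A), hφ.iff, map_neg, ← jordanProduct_neg, hA] at h2
      have := key _ h2
      rw [_root_.neg_apply, map_neg] at this
      rw [← this, neg_neg]
  have h2 : ∀ x : K, φ 1 x = x ∨ φ 1 x = -x := by
    intro x
    by_cases hc : ∃ c : 𝕜, φ 1 x = c • x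
    · obtain ⟨c, hc⟩ := hc
      rcases eq_or_ne x 0 with rfl | hx
      · left; simp
      obtain ⟨f, hf⟩ := SeparatingDual.exists_eq_one (R := 𝕜) hx
      have := h1 x f hf
      rw [hc, map_smul, hf, smul_eq_mul, mul_one] at this
      rcases this with h | h
      · left; rw [hc, h, one_smul]
      · right; rw [hc, h, neg_one_smul]
    · exfalso
      push Not at hc
      have hx : ∀ c : 𝕜, x ≠ c • φ 1 x := by
        intro c h
        rcases eq_or_ne c 0 with rfl | hc0
        · rw [zero_smul] at h
          exact hc 0 (by rw [h, map_zero, smul_zero])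
        · exact hc c⁻¹ (by conv_rhs => rw [h, smul_smul, inv_mul_cancel₀ hc0, one_smul])
      -- If x and φ(1)x were independent, some f would have f x = 1 and f(φ(1)x) = 0 ≠ ±1.
      obtain ⟨f, hf, hf0⟩ := exists_dual_eq_one_eq_zero hx
      rcases h1 x f hf with h | h <;> rw [hf0] at h <;> norm_num at h
  have h3 : (⊤ : AddSubgroup K) ≤ (φ 1 - 1).toLinearMap.toAddMonoidHom.ker ∨
      (⊤ : AddSubgroup K) ≤ (φ 1 + 1).toLinearMap.toAddMonoidHom.ker := by
    refine AddSubgroupClass.subset_union.1 fun x _ => ?_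
    rcases h2 x with h | h
    · left; show (φ 1 - 1) x = 0; simp [h]
    · right; show (φ 1 + 1) x = 0; simp [h]
  rcases h3 with h | h
  · left; ext x
    have : (φ 1 - 1) x = 0 := h (AddSubgroup.mem_top x)
    simpa [sub_eq_zero] using this
  · right; ext x
    have : (φ 1 + 1) x = 0 := h (AddSubgroup.mem_top x)
    simpa [add_eq_zero_iff_eq_neg] using this

theorem IsNonzeroIdempotent.not_isMinimalIdempotent_neg {X : H →L[𝕜] H}
    (hX : IsNonzeroIdempotent X) : ¬ IsMinimalIdempotent (-X) := by
  intro h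
  have := h.1.eq
  rw [neg_mul_neg, hX.1.eq] at this
  exact hX.2 (by rw [← half_smul_add_self (𝕜 := 𝕜) X, ← sub_neg_eq_add, ← this, sub_self,
    smul_zero])

theorem isMinimalIdempotent_map_iff
    (hmin : ∀ P : K →L[𝕜] K, IsMinimalIdempotent P → P ∈ Set.range φ)
    (hφ : PreservesNonzeroJordanIdempotency φ) (h1 : φ 1 = 1) (A : H →L[𝕜] H) :
    IsMinimalIdempotent (φ A) ↔ IsMinimalIdempotent A := by
  have hid : IsNonzeroIdempotent A ↔ IsNonzeroIdempotent (φ A) := by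
    have := hφ.iff A 1
    rwa [h1, jordanProduct_one, jordanProduct_one] at this
  constructor
  · intro h
    refine ((isMinimalIdempotent_or_neg_map_iff hmin hφ A).1 (Or.inl h)).resolve_right ?_
    exact (hid.2 h.isNonzeroIdempotent).not_isMinimalIdempotent_neg
  · intro h
    refine ((isMinimalIdempotent_or_neg_map_iff hmin hφ A).2 (Or.inl h)).resolve_right ?_
    exact (hid.1 h.isNonzeroIdempotent).not_isMinimalIdempotent_neg

/-- Shifting by the identity makes the criterion homogeneous: (S + 1)P = P means SP = 0. -/
theorem mul_eq_zero_or_iff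
    (hmin : ∀ P : K →L[𝕜] K, IsMinimalIdempotent P → P ∈ Set.range φ)
    (hφ : PreservesNonzeroJordanIdempotency φ) (h1 : φ 1 = 1) {P : H →L[𝕜] H}
    (hP : IsMinimalIdempotent P) (S : H →L[𝕜] H) :
    (S * P = 0 ∨ P * S = 0) ↔ (φ S * φ P = 0 ∨ φ P * φ S = 0) := by
  have h := hφ.iff P (S + 1)
  rw [isNonzeroIdempotent_jordanProduct_iff hP, isNonzeroIdempotent_jordanProduct_iff
    ((isMinimalIdempotent_map_iff hmin hφ h1 P).2 hP), map_add, h1] at h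
  simpa [add_mul, mul_add] using h

theorem exists_not_mem_span (hH : ¬ FiniteDimensional 𝕜 H) (x : H) :
    ∃ y : H, ∀ c : 𝕜, y ≠ c • x := by
  by_contra! h
  refine hH (Module.Finite.of_fg_top ⟨{x}, ?_⟩)
  rw [Finset.coe_singleton, eq_top_iff]
  intro y _
  obtain ⟨c, rfl⟩ := h y
  exact Submodule.smul_mem _ _ (Submodule.mem_span_singleton_self x)

theorem exists_ne_zero_apply_eq_zero (hH : ¬ FiniteDimensional 𝕜 H) {f : H →L[𝕜] 𝕜} {x : H}
    (hf : f x = 1) : ∃ w : H, f w = 0 ∧ w ≠ 0 ∧ ∀ c : 𝕜, w ≠ c • x := by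
  obtain ⟨y, hy⟩ := exists_not_mem_span hH x
  refine ⟨y - f y • x, by simp [hf], sub_ne_zero.2 (hy _), fun c hc => hy (c + f y) ?_⟩
  rw [add_smul, ← hc]; abel

/-- At a minimal idempotent `P`, the map preserves one-sided annihilation, either keeping or
exchanging the sides. -/
theorem annihilator_preserved_or_swapped (hH : ¬ FiniteDimensional 𝕜 H)
    (hmin : ∀ P : K →L[𝕜] K, IsMinimalIdempotent P → P ∈ Set.range φ)
    (hφ : PreservesNonzeroJordanIdempotency φ) (h1 : φ 1 = 1) {P : H →L[𝕜] H}
    (hP : IsMinimalIdempotent P) :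
    (∀ S, (S * P = 0 ↔ φ S * φ P = 0) ∧ (P * S = 0 ↔ φ P * φ S = 0)) ∨
    (∀ S, (S * P = 0 ↔ φ P * φ S = 0) ∧ (P * S = 0 ↔ φ S * φ P = 0)) := by
  let W₁ := (AddMonoidHom.mulRight P).ker
  let W₂ := (AddMonoidHom.mulLeft P).ker
  let V₁ := ((AddMonoidHom.mulRight (φ P)).comp φ).ker
  let V₂ := ((AddMonoidHom.mulLeft (φ P)).comp φ).ker
  have h : ∀ S, (S ∈ W₁ ∨ S ∈ W₂) ↔ (S ∈ V₁ ∨ S ∈ V₂) := mul_eq_zero_or_iff hmin hφ h1 hP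
  obtain ⟨x, f, hf, rfl⟩ := (isMinimalIdempotent_iff P).1 hP
  obtain ⟨w, hw, hw0, hwx⟩ := exists_ne_zero_apply_eq_zero hH hf
  obtain ⟨g, hg, hgx⟩ := exists_dual_eq_one_eq_zero hwx
  -- The annihilators are incomparable: g⊗x kills P only from the left, and f⊗w only from the right.
  have h12 : ¬ W₁ ≤ W₂ := by
    intro hle
    have hmem : g.smulRight x ∈ W₁ := by
      show g.smulRight x * f.smulRight x = 0
      rw [smulRight_mul_smulRight, hgx, zero_smul]
    have : f.smulRight x * g.smulRight x = 0 := hle hmem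
    rw [smulRight_mul_smulRight, hf, one_smul] at this
    exact (ne_zero_of_apply_eq_one hf).2 (smulRight_eq_zero this (ne_zero_of_apply_eq_one hg).1)
  have h21 : ¬ W₂ ≤ W₁ := by
    intro hle
    have hmem : f.smulRight w ∈ W₂ := by
      show f.smulRight x * f.smulRight w = 0
      rw [smulRight_mul_smulRight, hw, zero_smul]
    have : f.smulRight w * f.smulRight x = 0 := hle hmem
    rw [smulRight_mul_smulRight, hf, one_smul] at this
    exact hw0 (smulRight_eq_zero this (ne_zero_of_apply_eq_one hf).1)
  rcases AddSubgroup.eq_or_swap_of_union_eq h h12 h21 with ⟨e1, e2⟩ | ⟨e1, e2⟩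
  · exact Or.inl fun S => ⟨SetLike.ext_iff.1 e1 S, SetLike.ext_iff.1 e2 S⟩
  · exact Or.inr fun S => ⟨SetLike.ext_iff.1 e1 S, SetLike.ext_iff.1 e2 S⟩

/-- Whether sides are kept or exchanged does not depend on the minimal idempotent. -/
theorem annihilator_preserved_or_swapped_uniform (hH : ¬ FiniteDimensional 𝕜 H)
    (hmin : ∀ P : K →L[𝕜] K, IsMinimalIdempotent P → P ∈ Set.range φ)
    (hφ : PreservesNonzeroJordanIdempotency φ) (h1 : φ 1 = 1) :
    (∀ P, IsMinimalIdempotent P → ∀ S, (S * P = 0 ↔ φ S * φ P = 0)) ∨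
    (∀ P, IsMinimalIdempotent P → ∀ S, (P * S = 0 ↔ φ S * φ P = 0)) := by
  have dich := fun {P} hP => annihilator_preserved_or_swapped hH hmin hφ h1 (P := P) hP
  have hinj : ∀ S, φ S = 0 → S = 0 := by
    intro S hS
    ext x
    rcases eq_or_ne x 0 with rfl | hx
    · simp
    obtain ⟨f, hf⟩ := SeparatingDual.exists_eq_one (R := 𝕜) hx
    have hSP : S * f.smulRight x = 0 := by
      rcases dich (isMinimalIdempotent_smulRight hf) with h | h
      · exact (h S).1.2 (by rw [hS, zero_mul])
      · exact (h S).1.2 (by rw [hS, mul_zero])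
    have := congrArg (fun T : H →L[𝕜] H => T x) hSP
    simpa [hf] using this
  have hinj' : ∀ P P', φ P = φ P' → P = P' := fun P P' h =>
    sub_eq_zero.1 (hinj _ (by rw [map_sub, h, sub_self]))
  let a : (H →L[𝕜] H) → Prop := fun P =>
    ∀ S, (S * P = 0 ↔ φ S * φ P = 0) ∧ (P * S = 0 ↔ φ P * φ S = 0)
  -- Idempotents with the same range are of the same kind: otherwise φ(P')φ(P) would equal both φ(P)
  -- and φ(P'), and injectivity gives P = P'. `kernel_step` is the analogue for a common kernel.
  have range_step : ∀ P P', IsMinimalIdempotent P' → a P → P * P' = P' → P' * P = P →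
      a P' := by
    intro P P' hP' ha e1 e2
    rcases dich hP' with h | h
    · exact h
    · have i1 : φ P' * φ P = φ P := by
        have := (ha (P' - 1)).1.1 (sub_one_mul_eq_zero_iff.2 e2)
        rwa [map_sub, h1, sub_one_mul_eq_zero_iff] at this
      have i2 : φ P' * φ P = φ P' := by
        have := (h (P - 1)).1.1 (sub_one_mul_eq_zero_iff.2 e1)
        rwa [map_sub, h1, mul_sub_one_eq_zero_iff] at this
      rw [hinj' P' P (i2.symm.trans i1)]; exact ha
  have kernel_step : ∀ P P', IsMinimalIdempotent P' → a P → P * P' = P → P' * P = P' →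
      a P' := by
    intro P P' hP' ha e1 e2
    rcases dich hP' with h | h
    · exact h
    · have i1 : φ P * φ P' = φ P := by
        have := (ha (P' - 1)).2.1 (mul_sub_one_eq_zero_iff.2 e1)
        rwa [map_sub, h1, mul_sub_one_eq_zero_iff] at this
      have i2 : φ P * φ P' = φ P' := by
        have := (h (P - 1)).2.1 (mul_sub_one_eq_zero_iff.2 e2)
        rwa [map_sub, h1, sub_one_mul_eq_zero_iff] at this
      rw [hinj' P' P (i2.symm.trans i1)]; exact ha
  by_cases hex : ∃ P, IsMinimalIdempotent P ∧ a P
  · left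
    obtain ⟨P, hP, ha⟩ := hex
    intro P' hP'
    suffices a P' from fun S => (this S).1
    obtain ⟨x, f, hf, rfl⟩ := (isMinimalIdempotent_iff P).1 hP
    obtain ⟨x', f', hf', rfl⟩ := (isMinimalIdempotent_iff P').1 hP'
    -- A functional h nonzero at x and x' links f⊗x to f'⊗x': change the functional to h, then the
    -- vector to a multiple of x', then the functional to f'.
    obtain ⟨h, hx, hx'⟩ := SeparatingDual.exists_eq_one_ne_zero_of_ne_zero_pair (R := 𝕜)
      (ne_zero_of_apply_eq_one hf).2 (ne_zero_of_apply_eq_one hf').2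
    have hu : h ((h x')⁻¹ • x') = 1 := by simpa using inv_mul_cancel₀ hx'
    have hk : ((h x')⁻¹ • h) x' = 1 := by simpa using inv_mul_cancel₀ hx'
    have a1 : a (h.smulRight x) := range_step _ _ (isMinimalIdempotent_smulRight hx) ha
      (by simp [smulRight_mul_smulRight, hf]) (by simp [smulRight_mul_smulRight, hx])
    have a2 : a (h.smulRight ((h x')⁻¹ • x')) := kernel_step _ _ (isMinimalIdempotent_smulRight hu)
      a1 (by rw [smulRight_mul_smulRight, hu, one_smul])
      (by rw [smulRight_mul_smulRight, hx, one_smul])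
    have e : h.smulRight ((h x')⁻¹ • x') = ((h x')⁻¹ • h).smulRight x' := by
      ext z; simp [smul_smul, mul_comm]
    rw [e] at a2
    exact range_step _ _ hP' a2 (by rw [smulRight_mul_smulRight, hk, one_smul])
      (by rw [smulRight_mul_smulRight, hf', one_smul])
  · right
    push Not at hex
    intro P hP S
    exact (((dich hP).resolve_left (hex P hP)) S).2

end Preserver

/-! ### Bounded ring endomorphisms of the scalars. -/

section ScalarRingHom

variable {𝕜 : Type*} [RCLike 𝕜]

/-- A ring endomorphism of `ℝ` or `ℂ` that is bounded on the unit ball is the identity or the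
conjugation. -/
theorem RCLike.ringHom_eq_id_or_conj_of_bounded (σ : 𝕜 →+* 𝕜) {C : ℝ}
    (hC : ∀ c : 𝕜, ‖c‖ ≤ 1 → ‖σ c‖ ≤ C) : σ = RingHom.id 𝕜 ∨ σ = starRingEnd 𝕜 := by
  have hcont : Continuous σ := by
    refine continuous_of_continuousAt_zero σ (Metric.continuousAt_iff.2 fun ε hε => ?_)
    obtain ⟨n, hn⟩ := exists_nat_gt (C / ε)
    have hC0 : 0 ≤ C := (norm_nonneg _).trans (hC 0 (by simp))
    have hn0 : (0 : ℝ) < n := lt_of_le_of_lt (by positivity) hn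
    refine ⟨(n : ℝ)⁻¹, by positivity, fun {c} hc => ?_⟩
    rw [dist_zero_right] at hc
    rw [map_zero, dist_zero_right]
    -- Additivity gives σ(nc) = nσ(c), so a bound C on the unit ball becomes C/n on the ball of
    -- radius 1/n.
    have h1 : ‖(n : 𝕜) * c‖ ≤ 1 := by
      rw [norm_mul, RCLike.norm_natCast]
      calc (n : ℝ) * ‖c‖ ≤ n * (n : ℝ)⁻¹ := by gcongr
        _ = 1 := mul_inv_cancel₀ hn0.ne'
    have h2 := hC _ h1
    rw [map_mul, map_natCast, norm_mul, RCLike.norm_natCast] at h2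
    rw [div_lt_iff₀ hε] at hn
    exact lt_of_mul_lt_mul_left (h2.trans_lt hn) hn0.le
  have hreal : ∀ r : ℝ, σ (r : 𝕜) = r := by
    intro r
    have := map_real_smul σ hcont r 1
    rwa [map_one, Algebra.smul_def, mul_one] at this
  have hI : σ RCLike.I = RCLike.I ∨ σ RCLike.I = -RCLike.I := by
    rcases RCLike.I_mul_I (K := 𝕜) with h | h
    · left; rw [h, map_zero]
    · have h2 := congrArg σ h
      rw [map_mul, map_neg, map_one, ← h] at h2
      exact mul_self_eq_mul_self_iff.1 h2
  rcases hI with h | h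
  · left
    ext z
    rw [← RCLike.re_add_im z]
    simp only [map_add, map_mul, hreal, h, RingHom.id_apply]
  · right
    ext z
    conv_lhs => rw [← RCLike.re_add_im z]
    rw [RCLike.conj_eq_re_sub_im]
    simp only [map_add, map_mul, hreal, h]
    ring

end ScalarRingHom

/-! ### Automatic continuity and diagonal operators. -/

section Continuity

variable {𝕜 H K : Type*} [RCLike 𝕜] [NormedAddCommGroup H] [InnerProductSpace 𝕜 H]
  [CompleteSpace H] [NormedAddCommGroup K] [InnerProductSpace 𝕜 K] [CompleteSpace K]

/-- An additive, real-homogeneous map is continuous if it is weakly continuous. -/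
theorem continuous_of_forall_dual_comp (B : K →+ H)
    (hB : ∀ (r : ℝ) v, B ((r : 𝕜) • v) = (r : 𝕜) • B v)
    (h : ∀ f : H →L[𝕜] 𝕜, Continuous fun v => f (B v)) : Continuous B := by
  let _ : NormedSpace ℝ H := NormedSpace.restrictScalars ℝ 𝕜 H
  let _ : NormedSpace ℝ K := NormedSpace.restrictScalars ℝ 𝕜 K
  let L : K →ₗ[ℝ] H := { B with map_smul' := hB }
  refine LinearMap.continuous_of_seq_closed_graph (g := L) fun u x y hu hy => ?_
  refine (SeparatingDual.eq_iff_forall_dual_eq (R := 𝕜)).2 fun f => ?_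
  exact tendsto_nhds_unique ((f.continuous.tendsto y).comp hy) (((h f).tendsto x).comp hu)

/-- The diagonal operator with summable entries along an orthonormal sequence. -/
theorem exists_diagonal_operator {e : ℕ → H} (he : Orthonormal 𝕜 e) {c : ℕ → 𝕜}
    (hc : Summable fun n => ‖c n‖) : ∃ T : H →L[𝕜] H, ∀ n, T (e n) = c n • e n := by
  let F : ℕ → H →L[𝕜] H := fun n => c n • (innerSL 𝕜 (e n)).smulRight (e n)
  have hF : Summable F := by
    refine Summable.of_norm_bounded hc fun n => ?_
    rw [norm_smul, ContinuousLinearMap.norm_smulRight_apply, innerSL_apply_norm, he.1 n]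
    simp
  refine ⟨∑' n, F n, fun k => ?_⟩
  have h1 : HasSum (fun n => F n (e k)) ((∑' n, F n) (e k)) :=
    hF.hasSum.mapL (ContinuousLinearMap.apply 𝕜 H (e k))
  have h2 := hasSum_single k (f := fun n => F n (e k)) fun n hn => by simp [F, he.2 hn]
  rw [h1.unique h2]
  simp [F, he.1 k]

theorem exists_orthonormal_sequence (hH : ¬ FiniteDimensional 𝕜 H) :
    ∃ e : ℕ → H, Orthonormal 𝕜 e := by
  obtain ⟨w, b, -⟩ := exists_hilbertBasis 𝕜 H
  have : Infinite w := by
    by_contra hfin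
    rw [not_infinite_iff_finite] at hfin
    have := Fintype.ofFinite w
    exact hH b.toOrthonormalBasis.toBasis.finiteDimensional_of_finite
  exact ⟨b ∘ Infinite.natEmbedding w, b.orthonormal.comp _ (Infinite.natEmbedding w).injective⟩

end Continuity

/-! ### Implementing a side-preserving map by an additive bijection. -/

section SidePreserving

variable {𝕜 H K : Type*} [RCLike 𝕜] [NormedAddCommGroup H] [InnerProductSpace 𝕜 H]
  [NormedAddCommGroup K] [InnerProductSpace 𝕜 K] {φ : (H →L[𝕜] H) →+ (K →L[𝕜] K)}

/-- From (TP - T)P = 0 comes φ(TP)φ(P) = φ(T)φ(P). It remains that φ(TP) kills ker φ(P): a nonzero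
vector there spans the range of some minimal φ(P'), and PP' = 0 gives φ(TP)φ(P') = 0. -/
theorem map_mul_minimalIdempotent
    (hmin : ∀ P : K →L[𝕜] K, IsMinimalIdempotent P → P ∈ Set.range φ)
    (hP : ∀ A, IsMinimalIdempotent (φ A) ↔ IsMinimalIdempotent A)
    (ha : ∀ P, IsMinimalIdempotent P → ∀ S, (S * P = 0 ↔ φ S * φ P = 0))
    {P : H →L[𝕜] H} (hPm : IsMinimalIdempotent P) (T : H →L[𝕜] H) : φ (T * P) = φ T * φ P := by
  have h1 : φ (T * P) * φ P = φ T * φ P := by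
    have := (ha P hPm (T * P - T)).1 (by rw [sub_mul, mul_assoc, hPm.1.eq, sub_self])
    rwa [map_sub, sub_mul, sub_eq_zero] at this
  have hQ := ((hP P).2 hPm).1
  rw [← h1]
  ext z
  rw [mul_apply_eq_comp, ← sub_eq_zero, ← map_sub]
  by_cases hz : z - φ P z = 0
  · rw [hz, map_zero]
  obtain ⟨h, hh⟩ := SeparatingDual.exists_eq_one (R := 𝕜) hz
  obtain ⟨P', hP'⟩ := hmin _ (isMinimalIdempotent_smulRight hh)
  have hPm' : IsMinimalIdempotent P' := (hP P').1 (hP' ▸ isMinimalIdempotent_smulRight hh)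
  have hPP' : P * P' = 0 := by
    rw [ha P' hPm', hP', mul_smulRight, map_sub, ← mul_apply_eq_comp, hQ.eq, sub_self]
    ext; simp
  have := (ha P' hPm' (T * P)).1 (by rw [mul_assoc, hPP', mul_zero])
  rw [hP', mul_smulRight] at this
  exact smulRight_eq_zero this (ne_zero_of_apply_eq_one hh).1

/-- The right factors at which φ is multiplicative form a non-unital subring containing the minimal
idempotents, hence the rank-one nilpotents. If f u ≠ 0, then f⊗u is a product of two of these. -/
theorem map_mul_smulRight (hH : ¬ FiniteDimensional 𝕜 H)
    (hmul : ∀ P, IsMinimalIdempotent P → ∀ T, φ (T * P) = φ T * φ P)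
    (f : H →L[𝕜] 𝕜) (u : H) (T : H →L[𝕜] H) :
    φ (T * f.smulRight u) = φ T * φ (f.smulRight u) := by
  let G : NonUnitalSubring (H →L[𝕜] H) :=
    { carrier := {S | ∀ T, φ (T * S) = φ T * φ S}
      add_mem' := fun {a b} ha hb T => by rw [mul_add, map_add, ha, hb, map_add, mul_add]
      zero_mem' := fun T => by rw [mul_zero, map_zero, mul_zero]
      neg_mem' := fun {a} ha T => by rw [mul_neg, map_neg, ha, map_neg, mul_neg]
      mul_mem' := fun {a b} ha hb T => by
        rw [← mul_assoc, hb, ha, hb, mul_assoc] }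
  have hcl : AddSubgroup.closure {P : H →L[𝕜] H | IsMinimalIdempotent P} ≤ G.toAddSubgroup :=
    (AddSubgroup.closure_le _).2 fun P hP => hmul P hP
  suffices f.smulRight u ∈ G from this T
  by_cases hfu : f u = 0
  · exact hcl (smulRight_mem_closure_of_apply_eq_zero hfu)
  obtain ⟨w, hw, -, hwu⟩ := exists_ne_zero_apply_eq_zero hH (f := (f u)⁻¹ • f) (x := u)
    (by simpa using inv_mul_cancel₀ hfu)
  obtain ⟨h, hhw, hhu⟩ := exists_dual_eq_one_eq_zero hwu
  have hfw : f w = 0 := by simpa [hfu] using hw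
  have e : f.smulRight u = h.smulRight u * f.smulRight w := by
    rw [smulRight_mul_smulRight, hhw, one_smul]
  rw [e]
  exact G.mul_mem (hcl (smulRight_mem_closure_of_apply_eq_zero hhu))
    (hcl (smulRight_mem_closure_of_apply_eq_zero hfw))

/-- A side-preserving `φ` is implemented by an additive bijection, homogeneous with respect to a
ring endomorphism of the scalars. -/
theorem exists_intertwining_addEquiv (hH : ¬ FiniteDimensional 𝕜 H)
    (hK : ¬ FiniteDimensional 𝕜 K)
    (hmin : ∀ P : K →L[𝕜] K, IsMinimalIdempotent P → P ∈ Set.range φ)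
    (hP : ∀ A, IsMinimalIdempotent (φ A) ↔ IsMinimalIdempotent A)
    (ha : ∀ P, IsMinimalIdempotent P → ∀ S, (S * P = 0 ↔ φ S * φ P = 0)) :
    ∃ (A : H ≃+ K) (σ : 𝕜 →+* 𝕜), (∀ T u, φ T (A u) = A (T u)) ∧
      ∀ (c : 𝕜) u, A (c • u) = σ c • A u := by
  have hmul := fun P hPm => map_mul_minimalIdempotent hmin hP ha (P := P) hPm
  have hmul' := map_mul_smulRight hH hmul
  obtain ⟨x₀, hx₀⟩ := exists_not_mem_span hH (0 : H)
  have hx₀' : x₀ ≠ 0 := by simpa using hx₀ 0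
  obtain ⟨f₀, hf₀⟩ := SeparatingDual.exists_eq_one (R := 𝕜) hx₀'
  have hP₀ := isMinimalIdempotent_smulRight hf₀
  obtain ⟨y₀, g₀, hg₀, hφP₀⟩ := (isMinimalIdempotent_iff _).1 ((hP _).2 hP₀)
  -- Operators f₀⊗u are a copy of H on which B(H) acts by left multiplication; evaluation at y₀,
  -- which spans the range of φ(f₀⊗x₀), carries this copy to K.
  let A : H →+ K :=
    { toFun := fun u => φ (f₀.smulRight u) y₀
      map_zero' := by simp [show f₀.smulRight (0 : H) = 0 by ext; simp]
      map_add' := fun u v => by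
        rw [show f₀.smulRight (u + v) = f₀.smulRight u + f₀.smulRight v by ext; simp, map_add]
        rfl }
  have hA : ∀ u, A u = φ (f₀.smulRight u) y₀ := fun _ => rfl
  have hAT : ∀ T u, φ T (A u) = A (T u) := by
    intro T u
    rw [hA, hA, ← mul_smulRight, hmul', mul_apply_eq_comp]
  have hA₀ : A x₀ = y₀ := by rw [hA, hφP₀]; simp [hg₀]
  have hy₀ : y₀ ≠ 0 := (ne_zero_of_apply_eq_one hg₀).2
  have hinj : Function.Injective A := by
    refine (injective_iff_map_eq_zero A).2 fun u hu => ?_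
    by_contra hu0
    obtain ⟨f, hf⟩ := SeparatingDual.exists_eq_one (R := 𝕜) hu0
    have := hAT (f.smulRight x₀) u
    rw [hu, map_zero, ContinuousLinearMap.smulRight_apply, hf, one_smul, hA₀] at this
    exact hy₀ this.symm
  have hsurj' : ∀ v : K, (∀ c : 𝕜, v ≠ c • y₀) → v ∈ A.range := by
    intro v hv
    obtain ⟨g, hgv, hgy⟩ := exists_dual_eq_one_eq_zero hv
    -- This functional is 1 at both v and y₀, so its rank-one idempotent onto v sends y₀ to v.
    have hgv' : (g + g₀ - g₀ v • g) v = 1 := by simp [hgv]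
    have hgy' : (g + g₀ - g₀ v • g) y₀ = 1 := by simp [hgy, hg₀]
    obtain ⟨T, hT⟩ := hmin _ (isMinimalIdempotent_smulRight hgv')
    refine ⟨T x₀, ?_⟩
    rw [← hAT, hA₀, hT, ContinuousLinearMap.smulRight_apply, hgy', one_smul]
  have hsurj : Function.Surjective A := by
    intro v
    change v ∈ A.range
    by_cases hv : ∃ c : 𝕜, v = c • y₀
    · obtain ⟨w, hw⟩ := exists_not_mem_span hK y₀
      obtain ⟨c, rfl⟩ := hv
      have h1 : c • y₀ + w ∈ A.range := hsurj' _ fun d hd => hw (d - c) (by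
        rw [sub_smul, ← hd]; abel)
      have := A.range.sub_mem h1 (hsurj' w hw)
      rwa [add_sub_cancel_right] at this
    · push Not at hv
      exact hsurj' v hv
  have hscalar : ∀ c : 𝕜, ∃ d : 𝕜, ∀ v, φ (c • 1) v = d • v := by
    intro c
    -- Commuting with the rank-one φ(f₀⊗x₀) makes y₀ an eigenvector of φ(c1); commuting with every
    -- φ(f₀⊗u) spreads the eigenvalue to all of K.
    have hcomm : ∀ T v, φ T (φ (c • 1) v) = φ (c • 1) (φ T v) := by
      intro T v
      obtain ⟨u, rfl⟩ := hsurj v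
      rw [hAT, hAT, hAT, hAT]
      simp
    have h₀ : φ (c • 1) y₀ = g₀ (φ (c • 1) y₀) • y₀ := by
      have := hcomm (f₀.smulRight x₀) y₀
      simpa [hφP₀, hg₀] using this.symm
    refine ⟨g₀ (φ (c • 1) y₀), fun v => ?_⟩
    obtain ⟨u, rfl⟩ := hsurj v
    rw [hA, ← hcomm, h₀, map_smul, ← h₀]
  choose s hs using hscalar
  have hAs : ∀ (c : 𝕜) u, A (c • u) = s c • A u := by
    intro c u
    rw [← hs, hAT]; rfl
  have hcancel : ∀ {c d : 𝕜}, c • A x₀ = d • A x₀ → c = d := fun h =>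
    smul_left_injective 𝕜 (by rwa [hA₀]) h
  let σ : 𝕜 →+* 𝕜 :=
    { toFun := s
      map_one' := hcancel (by rw [← hAs, one_smul, one_smul])
      map_mul' := fun c d => hcancel (by rw [← hAs, mul_smul, hAs, hAs, smul_smul])
      map_zero' := hcancel (by rw [← hAs, zero_smul, zero_smul, map_zero])
      map_add' := fun c d => hcancel (by rw [← hAs, add_smul, map_add, hAs, hAs, add_smul]) }
  exact ⟨AddEquiv.ofBijective A ⟨hinj, hsurj⟩, σ, hAT, hAs⟩

end SidePreserving

/-! ### Boundedness of the implementing bijection. -/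

section Implementation

variable {𝕜 H K : Type*} [RCLike 𝕜] [NormedAddCommGroup H] [InnerProductSpace 𝕜 H]
  [CompleteSpace H] [NormedAddCommGroup K] [InnerProductSpace 𝕜 K]
  {φ : (H →L[𝕜] H) →+ (K →L[𝕜] K)}

/-- If |σ(cₙ)| > n2ⁿ with |cₙ| ≤ 1, the diagonal T with entries 2⁻ⁿcₙ is bounded, yet φ(T) has
eigenvalues 2⁻ⁿσ(cₙ) of modulus above n. -/
theorem bounded_of_intertwining (hH : ¬ FiniteDimensional 𝕜 H) {A : H ≃+ K} {σ : 𝕜 →+* 𝕜}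
    (hA : ∀ T u, φ T (A u) = A (T u)) (hσ : ∀ (c : 𝕜) u, A (c • u) = σ c • A u) :
    ∃ C : ℝ, ∀ c : 𝕜, ‖c‖ ≤ 1 → ‖σ c‖ ≤ C := by
  by_contra! h
  obtain ⟨e, he⟩ := exists_orthonormal_sequence hH
  choose c hc1 hc2 using fun n : ℕ => h (n * 2 ^ n)
  have hsum : Summable fun n => ‖(2⁻¹ : 𝕜) ^ n * c n‖ := by
    refine Summable.of_nonneg_of_le (fun _ => norm_nonneg _) (fun n => ?_)
      summable_geometric_two
    rw [norm_mul, norm_pow, norm_inv, RCLike.norm_ofNat, one_div]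
    exact mul_le_of_le_one_right (by positivity) (hc1 n)
  obtain ⟨T, hT⟩ := exists_diagonal_operator he hsum
  obtain ⟨n, hn⟩ := exists_nat_gt ‖φ T‖
  have hAe : 0 < ‖A (e n)‖ := norm_pos_iff.2 (by simpa using he.ne_zero n)
  have h1 := (φ T).le_opNorm (A (e n))
  rw [hA, hT, hσ, norm_smul] at h1
  have h2 := le_of_mul_le_mul_right h1 hAe
  rw [map_mul, map_pow, map_inv₀, map_ofNat, norm_mul, norm_pow, norm_inv, RCLike.norm_ofNat] at h2
  have h3 : (n : ℝ) < (2⁻¹ : ℝ) ^ n * ‖σ (c n)‖ := by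
    calc (n : ℝ) = (2⁻¹ : ℝ) ^ n * (n * 2 ^ n) := by
          rw [inv_pow]; field_simp
      _ < _ := by gcongr; exact hc2 n
  linarith

variable [CompleteSpace K]

/-- The bijection implementing `φ` is automatically bounded. -/
theorem exists_conjugateBy {A : H ≃+ K} {σ σ' : 𝕜 →+* 𝕜} [RingHomInvPair σ σ']
    [RingHomInvPair σ' σ] [RingHomIsometric σ] [RingHomIsometric σ']
    (hr : ∀ r : ℝ, σ (r : 𝕜) = r) (hA : ∀ T u, φ T (A u) = A (T u))
    (hσ : ∀ (c : 𝕜) u, A (c • u) = σ c • A u) :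
    ∃ B : H ≃SL[σ] K, ∀ T, φ T = conjugateBy B T := by
  let L : H ≃ₛₗ[σ] K := { A with map_smul' := hσ }
  have hsymm : Continuous A.symm := by
    refine continuous_of_forall_dual_comp (𝕜 := 𝕜) A.symm.toAddMonoidHom (fun r v => ?_)
      fun f => ?_
    · change A.symm _ = _ • A.symm v
      rw [AddEquiv.symm_apply_eq, hσ, hr, AddEquiv.apply_symm_apply]
    · change Continuous fun v => f (A.symm v)
      rcases subsingleton_or_nontrivial H with hs | hs
      · rw [show (fun v => f (A.symm v)) = fun _ => 0 by
          funext v; rw [Subsingleton.elim (A.symm v) 0, map_zero]]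
        exact continuous_const
      obtain ⟨u, hu⟩ := exists_ne (0 : H)
      obtain ⟨g, hg⟩ := SeparatingDual.exists_eq_one (R := 𝕜)
        (show A u ≠ 0 by simpa using hu)
      -- The bounded operator φ(f⊗u) sends v to σ(f(A⁻¹v))Au, which exhibits f∘A⁻¹ as continuous.
      have h1 : ∀ v, g (φ (f.smulRight u) v) = σ (f (A.symm v)) := by
        intro v
        conv_lhs => rw [← A.apply_symm_apply v]
        rw [hA, ContinuousLinearMap.smulRight_apply, hσ, map_smul, hg, smul_eq_mul, mul_one]
      have h2 : ∀ v, f (A.symm v) = σ' (g (φ (f.smulRight u) v)) := fun v => by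
        rw [h1, RingHomInvPair.comp_apply_eq]
      simp only [h2]
      have hσ' : Continuous σ' :=
        AddMonoidHomClass.continuous_of_bound σ' 1 fun x => by
          rw [one_mul, RingHomIsometric.norm_map]
      exact hσ'.comp (g.continuous.comp (φ (f.smulRight u)).continuous)
  let M : K ≃SL[σ'] H := L.symm.toContinuousLinearEquivOfContinuous hsymm
  refine ⟨M.symm, fun T => ?_⟩
  ext v
  change φ T v = A (T (A.symm v))
  rw [← hA, A.apply_symm_apply]

theorem exists_linear_or_conjLinear_conjugateBy (hH : ¬ FiniteDimensional 𝕜 H)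
    (hK : ¬ FiniteDimensional 𝕜 K)
    (hmin : ∀ P : K →L[𝕜] K, IsMinimalIdempotent P → P ∈ Set.range φ)
    (hP : ∀ A, IsMinimalIdempotent (φ A) ↔ IsMinimalIdempotent A)
    (ha : ∀ P, IsMinimalIdempotent P → ∀ S, (S * P = 0 ↔ φ S * φ P = 0)) :
    (∃ A : H ≃L[𝕜] K, ∀ T, φ T = conjugateBy A T) ∨
    ((RCLike.I : 𝕜) ≠ 0 ∧ ∃ A : H ≃SL[starRingEnd 𝕜] K, ∀ T, φ T = conjugateBy A T) := by
  obtain ⟨A, σ, hA, hσ⟩ := exists_intertwining_addEquiv hH hK hmin hP ha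
  obtain ⟨C, hC⟩ := bounded_of_intertwining hH hA hσ
  have linear_case : σ = RingHom.id 𝕜 → ∃ A : H ≃L[𝕜] K, ∀ T, φ T = conjugateBy A T := by
    rintro rfl
    exact exists_conjugateBy (fun _ => rfl) hA hσ
  rcases RCLike.ringHom_eq_id_or_conj_of_bounded σ hC with h | h
  · exact Or.inl (linear_case h)
  · by_cases hI : (RCLike.I : 𝕜) = 0
    -- Over the reals I = 0 and the conjugation is the identity.
    · refine Or.inl (linear_case ?_)
      ext z
      rw [h, RCLike.conj_eq_re_sub_im, hI, mul_zero, sub_zero, RingHom.id_apply]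
      conv_rhs => rw [← RCLike.re_add_im z, hI, mul_zero, add_zero]
    · subst h
      exact Or.inr ⟨hI, exists_conjugateBy (fun r => RCLike.conj_ofReal r) hA hσ⟩

end Implementation

/-! ### The transpose as an anti-automorphism. -/

section Transpose

variable {ι 𝕜 H : Type*} [RCLike 𝕜] [NormedAddCommGroup H] [InnerProductSpace 𝕜 H]
  (b : HilbertBasis ι 𝕜 H)

theorem basisConj_basisConj (x : H) : basisConj b (basisConj b x) = x := by
  simp [basisConj]

theorem ext_inner_hilbertBasis {S T : H →L[𝕜] H} (h : ∀ i j, ⟪b i, S (b j)⟫_𝕜 = ⟪b i, T (b j)⟫_𝕜) :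
    S = T := by
  have h1 : ∀ j, S (b j) = T (b j) := fun j => b.repr.injective (by
    ext i; rw [b.repr_apply_apply, b.repr_apply_apply, h])
  refine ContinuousLinearMap.ext_on (s := Set.range b) ?_ (by rintro _ ⟨j, rfl⟩; exact h1 j)
  rw [Submodule.dense_iff_topologicalClosure_eq_top]
  exact b.dense_span

variable [CompleteSpace H]

theorem basisTranspose_add (S T : H →L[𝕜] H) :
    basisTranspose b (S + T) = basisTranspose b S + basisTranspose b T :=
  ext_inner_hilbertBasis b fun i j => by
    simp [inner_basisTranspose, inner_add_right]

theorem basisTranspose_basisTranspose (T : H →L[𝕜] H) :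
    basisTranspose b (basisTranspose b T) = T :=
  ext_inner_hilbertBasis b fun i j => by rw [inner_basisTranspose, inner_basisTranspose]

theorem basisTranspose_mul (S T : H →L[𝕜] H) :
    basisTranspose b (S * T) = basisTranspose b T * basisTranspose b S := by
  ext x
  have h : ∀ (R : H →L[𝕜] H) y,
    basisTranspose b R y = basisConj b (ContinuousLinearMap.adjoint R (basisConj b y)) :=
    fun _ _ => rfl
  rw [mul_apply_eq_comp, h, h, h, basisConj_basisConj, ContinuousLinearMap.mul_def,
    ContinuousLinearMap.adjoint_comp, ContinuousLinearMap.comp_apply]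

/-- The transpose as an additive map. -/
noncomputable def basisTransposeAddHom : (H →L[𝕜] H) →+ (H →L[𝕜] H) :=
  AddMonoidHom.mk' (basisTranspose b) (basisTranspose_add b)

theorem basisTranspose_injective : Function.Injective (basisTranspose b) :=
  Function.LeftInverse.injective (basisTranspose_basisTranspose b)

theorem basisTranspose_eq_zero {T : H →L[𝕜] H} : basisTranspose b T = 0 ↔ T = 0 :=
  map_eq_zero_iff (basisTransposeAddHom b) (basisTranspose_injective b)

theorem basisTranspose_mul_eq_zero {S T : H →L[𝕜] H} :
    basisTranspose b S * basisTranspose b T = 0 ↔ T * S = 0 := by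
  rw [← basisTranspose_mul, basisTranspose_eq_zero]

theorem isMinimalIdempotent_basisTranspose_iff {P : H →L[𝕜] H} :
    IsMinimalIdempotent (basisTranspose b P) ↔ IsMinimalIdempotent P := by
  have key : ∀ P : H →L[𝕜] H, IsMinimalIdempotent P → IsMinimalIdempotent (basisTranspose b P) := by
    rintro P ⟨h1, h2, h3⟩
    refine ⟨?_, (basisTranspose_eq_zero b).not.2 h2, fun Q hQ e1 e2 => ?_⟩
    · rw [IsIdempotentElem, ← basisTranspose_mul, h1.eq]
    · obtain ⟨R, rfl⟩ : ∃ R, basisTranspose b R = Q := ⟨_, basisTranspose_basisTranspose b Q⟩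
      rw [← basisTranspose_mul] at e1 e2
      rw [IsIdempotentElem, ← basisTranspose_mul] at hQ
      have inj := basisTranspose_injective b
      refine (h3 R (inj hQ) (inj e2) (inj e1)).imp (basisTranspose_eq_zero b).2 fun h => by rw [h]
  exact ⟨fun h => basisTranspose_basisTranspose b P ▸ key _ h, key P⟩

end Transpose

/-! ### Assembling the representation. -/

section Main

variable {𝕜 H K ι : Type*} [RCLike 𝕜] [NormedAddCommGroup H] [InnerProductSpace 𝕜 H]
  [CompleteSpace H] [NormedAddCommGroup K] [InnerProductSpace 𝕜 K] [CompleteSpace K]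

theorem exists_conjugateBy_of_map_one (hH : ¬ FiniteDimensional 𝕜 H)
    (hK : ¬ FiniteDimensional 𝕜 K) (b : HilbertBasis ι 𝕜 H)
    {φ : (H →L[𝕜] H) →+ (K →L[𝕜] K)}
    (hmin : ∀ P : K →L[𝕜] K, IsMinimalIdempotent P → P ∈ Set.range φ)
    (hφ : PreservesNonzeroJordanIdempotency φ) (h1 : φ 1 = 1) :
    (∃ A : H ≃L[𝕜] K,
      (∀ T, φ T = conjugateBy A T) ∨ (∀ T, φ T = conjugateBy A (basisTranspose b T))) ∨
    ((RCLike.I : 𝕜) ≠ 0 ∧ ∃ A : H ≃SL[starRingEnd 𝕜] K,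
      (∀ T, φ T = conjugateBy A T) ∨ (∀ T, φ T = conjugateBy A (basisTranspose b T))) := by
  have hP := isMinimalIdempotent_map_iff hmin hφ h1
  rcases annihilator_preserved_or_swapped_uniform hH hmin hφ h1 with ha | hb
  · rcases exists_linear_or_conjLinear_conjugateBy hH hK hmin hP ha with ⟨A, hA⟩ | ⟨hI, A, hA⟩
    · exact Or.inl ⟨A, Or.inl hA⟩
    · exact Or.inr ⟨hI, A, Or.inl hA⟩
  -- The transpose reverses products, so composing with it turns side-exchanging into
  -- side-preserving.
  · let ψ : (H →L[𝕜] H) →+ (K →L[𝕜] K) := φ.comp (basisTransposeAddHom b)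
    have hψ : ∀ T, φ T = ψ (basisTranspose b T) := fun T =>
      congrArg φ (basisTranspose_basisTranspose b T).symm
    have hminψ : ∀ P : K →L[𝕜] K, IsMinimalIdempotent P → P ∈ Set.range ψ := by
      intro P hP
      obtain ⟨T, hT⟩ := hmin P hP
      exact ⟨basisTranspose b T, by rw [← hψ, hT]⟩
    have hPψ : ∀ A, IsMinimalIdempotent (ψ A) ↔ IsMinimalIdempotent A := fun A =>
      (hP _).trans (isMinimalIdempotent_basisTranspose_iff b)
    have haψ : ∀ P, IsMinimalIdempotent P → ∀ S, (S * P = 0 ↔ ψ S * ψ P = 0) := by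
      intro P hPm S
      rw [← basisTranspose_mul_eq_zero b]
      exact hb _ ((isMinimalIdempotent_basisTranspose_iff b).2 hPm) _
    rcases exists_linear_or_conjLinear_conjugateBy hH hK hminψ hPψ haψ with ⟨A, hA⟩ | ⟨hI, A, hA⟩
    · exact Or.inl ⟨A, Or.inr fun T => by rw [hψ, hA]⟩
    · exact Or.inr ⟨hI, A, Or.inr fun T => by rw [hψ, hA]⟩

end Main

theorem theorem1p1 {𝕜 H K ι : Type*} [RCLike 𝕜]
    [NormedAddCommGroup H] [InnerProductSpace 𝕜 H] [CompleteSpace H]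
    [NormedAddCommGroup K] [InnerProductSpace 𝕜 K] [CompleteSpace K]
    (hH : ¬ FiniteDimensional 𝕜 H) (hK : ¬ FiniteDimensional 𝕜 K)
    (b : HilbertBasis ι 𝕜 H)
    (φ : (H →L[𝕜] H) →+ (K →L[𝕜] K))
    (hmin : ∀ P : K →L[𝕜] K, IsMinimalIdempotent P → P ∈ Set.range φ)
    (hone : (1 : K →L[𝕜] K) ∈ Set.range φ)
    (hφ : PreservesNonzeroJordanIdempotency φ) :
    (∀ P : H →L[𝕜] H, IsMinimalIdempotent P → φ P = 0) ∨
    ∃ ξ : 𝕜, (ξ = 1 ∨ ξ = -1) ∧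
      ((∃ A : H ≃L[𝕜] K,
          (∀ T, φ T = ξ • conjugateBy A T) ∨
          (∀ T, φ T = ξ • conjugateBy A (basisTranspose b T))) ∨
       -- the conjugate-linear alternative is only allowed over the complex field
       ((RCLike.I : 𝕜) ≠ 0 ∧ ∃ A : H ≃SL[starRingEnd 𝕜] K,
          (∀ T, φ T = ξ • conjugateBy A T) ∨
          (∀ T, φ T = ξ • conjugateBy A (basisTranspose b T)))) := by
  -- The degenerate alternative never occurs: P∘P = P is a nonzero idempotent, so φ(P) ≠ 0.
  right
  rcases map_one_eq_one_or_neg_one hmin hφ with h1 | h1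
  · refine ⟨1, Or.inl rfl, ?_⟩
    simpa only [one_smul] using exists_conjugateBy_of_map_one hH hK b hmin hφ h1
  · refine ⟨-1, Or.inr rfl, ?_⟩
    have hminneg : ∀ P : K →L[𝕜] K, IsMinimalIdempotent P → P ∈ Set.range (-φ) := by
      intro P hP
      obtain ⟨T, hT⟩ := hmin P hP
      exact ⟨-T, by rw [AddMonoidHom.neg_apply, map_neg, neg_neg, hT]⟩
    have hφneg : PreservesNonzeroJordanIdempotency (-φ) := by
      intro A B
      rw [AddMonoidHom.neg_apply, AddMonoidHom.neg_apply, jordanProduct_neg_neg]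
      exact hφ A B
    have := exists_conjugateBy_of_map_one hH hK b hminneg hφneg
      (by rw [AddMonoidHom.neg_apply, h1, neg_neg])
    simpa only [neg_one_smul, AddMonoidHom.neg_apply, neg_eq_iff_eq_neg] using this
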